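/- A \emph{continuous signature} is a topological space $E$ partitioned into clopen (possibly empty) subsets $E_n$, $n\in\{0,1,2,\dots\}$. An \emph{$E$-algebra} is a set $X$ together with maps $\Psi_n^X\colon E_n\times X^n\to X$ for all $n\ge 0$. A map $h\colon X\to Y$ of $E$-algebras is a \emph{homomorphism} if $h(\Psi_n^X(t,x_1,\dots,x_n))=\Psi_n^Y(t,h(x_1),\dots,h(x_n))$ for all $n\ge 0$, $t\in E_n$ and $x_1,\dots,x_n\in X$. An $E$-algebra $X$ with a topology is a \emph{semitopological $E$-algebra} if every $\Psi_n^X$ is separately continuous, that is, continuous in $t\in E_n$ and in each $x_i\in X$ when all the other variables are fixed. A topological space $X$ has \emph{caliber $\omega_1$} if every uncountable family of nonempty open subsets of $X$ has an uncountable subfamily with nonempty intersection. \textbf{Theorem.} Let $E$ be a continuous signature and let $X$ be a semitopological $E$-algebra. If $X$ is a compact Hausdorff space with caliber $\omega_1$ and $E$ is separable, then $X$ is $\mathbb R$-factorizable: for every continuous function $f\colon X\to\mathbb R$ there exist a separable metrizable semitopological $E$-algebra $Y$, a continuous homomorphism $h\colon X\to Y$ and a continuous function $g\colon Y\to\mathbb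 R$ such that $f=g\circ h$. -/

import Mathlib

universe u v w

/-- A continuous signature: a topological space `E` of operation symbols, with an arity function
all of whose fibres `E_n` are clopen. -/
class ContinuousSignature (E : Type u) [TopologicalSpace E] where
  /-- The arity of a symbol. -/
  arity : E → ℕ
  isClopen_fiber : ∀ n : ℕ, IsClopen {t : E | arity t = n}

/-- The subspace `E_n` of the `n`-ary symbols of a signature `E`. -/
abbrev ContinuousSignature.Symbols (E : Type u) [TopologicalSpace E] [ContinuousSignature E]
    (n : ℕ) : Type u :=
  {t : E // ContinuousSignature.arity t = n}

/-- The structure of an `E`-algebra on `X`: maps `E_n × X ^ n → X` for all `n`. -/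
class SigAlgebra (E : Type u) [TopologicalSpace E] [ContinuousSignature E] (X : Type v) where
  /-- The map `E_n × X ^ n → X`. -/
  op : ∀ n : ℕ, ContinuousSignature.Symbols E n → (Fin n → X) → X

/-- Separate continuity of a map `T × X ^ n → Z`: it is continuous in the variable from `T`, and in
each of the `n` variables from `X`, whenever all the other variables are fixed. -/
def SeparatelyContinuous {T : Type u} {X : Type v} {Z : Type w} [TopologicalSpace T]
    [TopologicalSpace X] [TopologicalSpace Z] {n : ℕ} (φ : T → (Fin n → X) → Z) : Prop :=
  (∀ x : Fin n → X, Continuous fun t : T => φ t x) ∧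
    ∀ (t : T) (x : Fin n → X) (i : Fin n), Continuous fun y : X => φ t (Function.update x i y)

/-- `X` is a semitopological `E`-algebra: all the maps `E_n × X ^ n → X` are separately
continuous. -/
def IsSemitopologicalAlgebra (E : Type u) [TopologicalSpace E] [ContinuousSignature E]
    (X : Type v) [TopologicalSpace X] [SigAlgebra E X] : Prop :=
  ∀ n : ℕ, SeparatelyContinuous (SigAlgebra.op (E := E) (X := X) n)

/-- `h` is a homomorphism of `E`-algebras. -/
def IsAlgebraHom (E : Type u) [TopologicalSpace E] [ContinuousSignature E] {X : Type v}
    {Y : Type w} [SigAlgebra E X] [SigAlgebra E Y] (h : X → Y) : Prop :=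
  ∀ (n : ℕ) (t : ContinuousSignature.Symbols E n) (x : Fin n → X),
    h (SigAlgebra.op n t x) = SigAlgebra.op n t (fun i => h (x i))

/-- `X` has caliber `ω₁`: every uncountable family of nonempty open sets has an uncountable
subfamily with nonempty intersection. -/
def HasCaliberOmegaOne (X : Type v) [TopologicalSpace X] : Prop :=
  ∀ 𝒰 : Set (Set X), (∀ U ∈ 𝒰, IsOpen U ∧ U.Nonempty) → ¬ 𝒰.Countable →
    ∃ 𝒱 ⊆ 𝒰, ¬ 𝒱.Countable ∧ (⋂₀ 𝒱).Nonempty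

/-- `ℝ`-factorizability of `X` as a semitopological `E`-algebra: every continuous real function on
`X` factors through a continuous homomorphism to a separable metrizable semitopological
`E`-algebra. -/
def IsRFactorizable (E : Type u) [TopologicalSpace E] [ContinuousSignature E]
    (X : Type v) [TopologicalSpace X] [SigAlgebra E X] : Prop :=
  ∀ f : X → ℝ, Continuous f →
    ∃ (Y : Type v) (_ : TopologicalSpace Y) (_ : SigAlgebra E Y) (g : Y → ℝ) (h : X → Y),
      TopologicalSpace.SeparableSpace Y ∧ TopologicalSpace.MetrizableSpace Y ∧
      IsSemitopologicalAlgebra E Y ∧ Continuous g ∧ Continuous h ∧ IsAlgebraHom E h ∧ f = g ∘ h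

open Set Function Filter Topology

/-! Identify two points when no function obtained from `f` by repeatedly substituting operations
tells them apart in any variable. By continuity in the symbol, a countable dense set of symbols
suffices, so only countably many separately continuous `F` arise. As the family is closed under
substitution, the identification is a congruence. The quotient is metrizable because each `F` is
determined in every variable by countably many values of the others
(`SepCont.exists_countable_determines`).

This last fact goes by induction on the number of variables. View `F` as a family `G d` of functions
of the remaining variables. If no countable set tells the `G d` apart, a chain of countable sets of
length `ω₁` carries pairs that agree on each set yet differ somewhere; caliber `ω₁` yields
uncountably many pairs differing by at least a fixed `ε` at one point. Limits along an increasing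
sequence of these (`not_forall_le_abs_sub`) agree on the closure of the union of the sets, hence
also at that point, whose coordinates can be traded for points of the closure: a contradiction. -/

/-- A real function of `n` variables is continuous in each variable. -/
def SepCont {X : Type v} [TopologicalSpace X] {n : ℕ} (F : (Fin n → X) → ℝ) : Prop :=
  ∀ (x : Fin n → X) (i : Fin n), Continuous fun y : X => F (update x i y)

/-- Two values of any one variable of `F` that give the same function of the remaining variables
on `C` give the same function everywhere. -/
def Determines {X : Type v} {n : ℕ} (F : (Fin n → X) → ℝ) (C : Set X) : Prop :=
  ∀ (i : Fin n) (x y : X),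
    (∀ c : Fin n → X, (∀ j, c j ∈ C) → F (update c i x) = F (update c i y)) →
      ∀ c : Fin n → X, F (update c i x) = F (update c i y)

theorem Determines.mono {X : Type v} {n : ℕ} {F : (Fin n → X) → ℝ} {C C' : Set X}
    (h : Determines F C) (hC : C ⊆ C') : Determines F C' :=
  fun i x y hxy => h i x y fun c hc => hxy c fun j => hC (hc j)

/-- Functions whose values do not change when `x i` is replaced by `y i`, for each `i`, take the
same value at `x` and at `y`. -/
theorem eq_of_forall_update_eq {X : Type v} {Z : Type w} {n : ℕ} {F : (Fin n → X) → Z}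
    {x y : Fin n → X} (h : ∀ i c, F (update c i (x i)) = F (update c i (y i))) : F x = F y := by
  have key : ∀ s : Finset (Fin n), F (s.piecewise x y) = F y := by
    intro s
    induction s using Finset.induction_on with
    | empty => simp
    | insert i s _ ih =>
      rw [Finset.piecewise_insert, h, ← ih]
      by_cases hi : i ∈ s
      · rw [← h]
        congr 1
        rw [update_eq_self_iff]
        simp [hi]
      · congr 1
        rw [update_eq_self_iff]
        simp [hi]
  simpa using key Finset.univ

/-- Separately continuous functions that agree on a power of `C` agree on the power of its
closure. -/
theorem SepCont.eq_on_closure {X : Type v} [TopologicalSpace X] {n : ℕ}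
    {F G : (Fin n → X) → ℝ} (hF : SepCont F) (hG : SepCont G) {C : Set X}
    (h : ∀ c : Fin n → X, (∀ j, c j ∈ C) → F c = G c) {r : Fin n → X}
    (hr : ∀ j, r j ∈ closure C) : F r = G r := by
  have key : ∀ s : Finset (Fin n), ∀ c : Fin n → X, (∀ j ∉ s, c j ∈ C) →
      (∀ j ∈ s, c j ∈ closure C) → F c = G c := by
    intro s
    induction s using Finset.induction_on with
    | empty => exact fun c hc _ => h c fun j => hc j (by simp)
    | insert i s hi ih =>
      intro c hc hc'
      have hclosed : IsClosed {y | F (update c i y) = G (update c i y)} :=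
        isClosed_eq (hF c i) (hG c i)
      have hsub : closure C ⊆ {y | F (update c i y) = G (update c i y)} := by
        refine hclosed.closure_subset_iff.2 fun y hy => ih _ ?_ ?_
        · intro j hj
          by_cases hji : j = i
          · subst hji; simpa using hy
          · rw [update_of_ne hji]; exact hc j (by simp [hji, hj])
        · intro j hj
          have hji : j ≠ i := fun e => hi (e ▸ hj)
          rw [update_of_ne hji]; exact hc' j (by simp [hj])
      simpa using hsub (hc' i (by simp))
  exact key Finset.univ r (by simp) fun j _ => hr j

/-! ### Caliber `ω₁` for families of functions -/

/-- The indexed form of caliber `ω₁`. -/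
theorem HasCaliberOmegaOne.exists_uncountable {X : Type v} [TopologicalSpace X]
    (hcal : HasCaliberOmegaOne X) {I : Type w} {S : Set I} (hS : ¬ S.Countable) {U : I → Set X}
    (hU : ∀ a ∈ S, IsOpen (U a) ∧ (U a).Nonempty) :
    ∃ S' ⊆ S, ¬ S'.Countable ∧ ∃ x, ∀ a ∈ S', x ∈ U a := by
  -- Caliber concerns sets of open sets; if `U` has few values, one of them is repeated uncountably
  -- often.
  by_cases hc : (U '' S).Countable
  · have hex : ∃ V ∈ U '' S, ¬ (S ∩ U ⁻¹' {V}).Countable := by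
      by_contra! hne
      refine hS ((hc.biUnion hne).mono fun a ha => ?_)
      exact mem_biUnion (mem_image_of_mem U ha) ⟨ha, rfl⟩
    obtain ⟨V, ⟨a, ha, rfl⟩, hV⟩ := hex
    obtain ⟨x, hx⟩ := (hU a ha).2
    refine ⟨_, inter_subset_left, hV, x, ?_⟩
    rintro b ⟨_, hb⟩
    rw [mem_preimage, mem_singleton_iff] at hb
    rwa [hb]
  · obtain ⟨𝒱, h𝒱, hunc, x, hx⟩ := hcal (U '' S) (by rintro _ ⟨a, ha, rfl⟩; exact hU a ha) hc
    refine ⟨S ∩ U ⁻¹' 𝒱, inter_subset_left, fun hcount => hunc ?_, x, fun a ha => hx _ ha.2⟩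
    refine (hcount.image U).mono fun V hV => ?_
    obtain ⟨a, ha, rfl⟩ := h𝒱 hV
    exact ⟨a, ⟨ha, hV⟩, rfl⟩

/-- In a space of caliber `ω₁`, uncountably many separately continuous functions, each of which has
a nonzero value, include uncountably many with a common point of nonvanishing. -/
theorem HasCaliberOmegaOne.exists_common_ne_zero {X : Type v} [TopologicalSpace X]
    (hcal : HasCaliberOmegaOne X) {I : Type w} {S : Set I} (hS : ¬ S.Countable) {n : ℕ}
    (H : I → (Fin n → X) → ℝ) (hH : ∀ a, SepCont (H a)) (t : I → Fin n → X)
    (ht : ∀ a, H a (t a) ≠ 0) :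
    ∃ S' ⊆ S, ¬ S'.Countable ∧ ∃ z, ∀ a ∈ S', H a z ≠ 0 := by
  -- The points `t a` are moved to a common `z` one coordinate at a time, thinning the index set at
  -- each step.
  have key : ∀ s : Finset (Fin n), ∃ S' ⊆ S, ¬ S'.Countable ∧
      ∃ z : Fin n → X, ∀ a ∈ S', H a (s.piecewise z (t a)) ≠ 0 := by
    intro s
    induction s using Finset.induction_on with
    | empty =>
      obtain ⟨a, -⟩ : S.Nonempty := nonempty_iff_ne_empty.2 fun h => hS (h ▸ countable_empty)
      exact ⟨S, Subset.rfl, hS, t a, fun b _ => by simpa using ht b⟩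
    | insert i s hi ih =>
      obtain ⟨S₁, hS₁, hunc, z, hz⟩ := ih
      obtain ⟨S₂, hS₂, hunc₂, x, hx⟩ := hcal.exists_uncountable hunc
        (U := fun a => {y | H a (update (s.piecewise z (t a)) i y) ≠ 0}) (fun a ha =>
          ⟨isOpen_ne_fun (hH a _ i) continuous_const,
            s.piecewise z (t a) i, by simpa using hz a ha⟩)
      refine ⟨S₂, hS₂.trans hS₁, hunc₂, update z i x, fun a ha => ?_⟩
      have := hx a ha
      rw [mem_ofPred_eq] at this
      rw [Finset.piecewise_insert, update_self]
      convert this using 3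
      refine s.piecewise_congr (fun j hj => ?_) fun _ _ => rfl
      exact update_of_ne (ne_of_mem_of_not_mem hj hi) _ _
  obtain ⟨S', h₁, h₂, z, hz⟩ := key Finset.univ
  exact ⟨S', h₁, h₂, z, by simpa using hz⟩

/-! ### Determination by countable sets -/

/-- Countably many continuous functions on a compact space take all their joint values on the
closure of a countable set. -/
theorem exists_countable_forall_mem_closure_eq {X : Type v} [TopologicalSpace X] [CompactSpace X]
    {J : Type w} [Countable J] (q : J → X → ℝ) (hq : ∀ j, Continuous (q j)) :
    ∃ C : Set X, C.Countable ∧ ∀ x, ∃ r ∈ closure C, ∀ j, q j r = q j x := by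
  have hQ : Continuous fun x j => q j x := continuous_pi hq
  obtain ⟨T, hT, hTc, hd⟩ := (TopologicalSpace.IsSeparable.of_separableSpace
    (range fun x j => q j x)).exists_countable_dense_subset
  obtain ⟨C, rfl, hinj⟩ := exists_image_eq_injOn_of_subset_range hT
  refine ⟨C, countable_of_injective_of_countable_image hinj hTc, fun x => ?_⟩
  have hsub : closure ((fun x j => q j x) '' C) ⊆ (fun x j => q j x) '' closure C :=
    closure_minimal (image_mono subset_closure) (isClosed_closure.isCompact.image hQ).isClosed
  obtain ⟨r, hr, h⟩ := hsub (hd (mem_range_self x))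
  exact ⟨r, hr, fun j => congr_fun h j⟩

/-- Let `C` be an increasing sequence of sets such that `C (k + 1)` determines the functions `G d`,
`d ∈ C k`, and has enough limit points to realize every value of a single variable as seen from
`C k`. If `v k, w k ∈ C (k + 1)` and `G (v k)`, `G (w k)` agree on `C k`, then the differences
`G (v k) - G (w k)` are not bounded away from zero at any point. -/
theorem not_forall_le_abs_sub {X : Type v} [TopologicalSpace X] [CompactSpace X] {n : ℕ}
    {G : X → (Fin n → X) → ℝ} (hG : ∀ d, SepCont (G d)) (hG' : ∀ t, Continuous fun d => G d t)
    {C : ℕ → Set X} (hC : Monotone C)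
    (hdet : ∀ k, ∀ d ∈ C k, Determines (G d) (C (k + 1)))
    (happ : ∀ k x, ∃ r ∈ closure (C (k + 1)), ∀ d ∈ C k, ∀ c : Fin n → X, (∀ j, c j ∈ C k) →
      ∀ i, G d (update c i r) = G d (update c i x))
    {v w : ℕ → X} (hv : ∀ k, v k ∈ C (k + 1)) (hw : ∀ k, w k ∈ C (k + 1))
    (hvw : ∀ k, ∀ c : Fin n → X, (∀ j, c j ∈ C k) → G (v k) c = G (w k) c)
    (t : Fin n → X) {ε : ℝ} (hε : 0 < ε) : ¬ ∀ k, ε ≤ |G (v k) t - G (w k) t| := by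
  intro hle
  -- `X` need not be sequentially compact, so limits are taken along an ultrafilter.
  let 𝒰 : Ultrafilter ℕ := hyperfilter ℕ
  have h𝒰 : (𝒰 : Filter ℕ) ≤ atTop := Nat.hyperfilter_le_atTop
  have hlim : ∀ a : ℕ → X, ∃ x, Tendsto a 𝒰 (𝓝 x) := fun a => by
    obtain ⟨x, -, hx⟩ := isCompact_univ.ultrafilter_le_nhds (𝒰.map a) (by simp)
    exact ⟨x, hx⟩
  have hmem : ∀ c : Fin n → X, (∀ j, c j ∈ ⋃ k, C k) → ∃ k, ∀ j, c j ∈ C k := by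
    intro c hc
    choose k hk using fun j => mem_iUnion.1 (hc j)
    exact ⟨Finset.univ.sup k, fun j => hC (Finset.le_sup (Finset.mem_univ j)) (hk j)⟩
  obtain ⟨x, hx⟩ := hlim v
  obtain ⟨y, hy⟩ := hlim w
  have hxt : ∀ s, Tendsto (fun k => G (v k) s) 𝒰 (𝓝 (G x s)) := fun s =>
    ((hG' s).tendsto x).comp hx
  have hyt : ∀ s, Tendsto (fun k => G (w k) s) 𝒰 (𝓝 (G y s)) := fun s =>
    ((hG' s).tendsto y).comp hy
  have hxy : ∀ c : Fin n → X, (∀ j, c j ∈ ⋃ k, C k) → G x c = G y c := by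
    intro c hc
    obtain ⟨k, hk⟩ := hmem c hc
    refine tendsto_nhds_unique_of_eventuallyEq (hxt c) (hyt c) (h𝒰 ?_)
    filter_upwards [eventually_ge_atTop k] with l hl using hvw l c fun j => hC hl (hk j)
  -- A limit `r` of approximations to `z` agrees with `z` as seen from the union; `hdet` extends
  -- this to all `c`.
  have hr : ∀ z, ∃ r ∈ closure (⋃ k, C k), ∀ d ∈ ⋃ k, C k, ∀ i c,
      G d (update c i r) = G d (update c i z) := by
    intro z
    choose a ha ha' using fun k => happ k z
    obtain ⟨r, hr⟩ := hlim a
    refine ⟨r, isClosed_closure.mem_of_tendsto hr (Eventually.of_forall fun k =>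
      closure_mono (subset_iUnion C _) (ha k)), ?_⟩
    intro d hd i
    obtain ⟨l, hl⟩ := mem_iUnion.1 hd
    refine ((hdet l d hl).mono (subset_iUnion C _)) i r z fun c hc => ?_
    obtain ⟨k, hk⟩ := hmem c hc
    refine tendsto_nhds_unique_of_eventuallyEq (((hG d c i).tendsto r).comp hr)
      tendsto_const_nhds (h𝒰 ?_)
    filter_upwards [eventually_ge_atTop k, eventually_ge_atTop l] with m hm hm'
    exact ha' m d (hC hm' hl) c (fun j => hC hm (hk j)) i
  choose r hrC hr using hr
  have hrt : ∀ d ∈ ⋃ k, C k, G d (fun i => r (t i)) = G d t := fun d hd =>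
    eq_of_forall_update_eq fun i c => hr (t i) d hd i c
  -- The trade is valid for every `G (v k)`, since `v k` lies in the union, and so for the limit `G
  -- x`.
  have e₁ : G x (fun i => r (t i)) = G x t := tendsto_nhds_unique_of_eventuallyEq (hxt _) (hxt _)
    (Eventually.of_forall fun k => hrt _ (mem_iUnion.2 ⟨_, hv k⟩))
  have e₂ : G y (fun i => r (t i)) = G y t := tendsto_nhds_unique_of_eventuallyEq (hyt _) (hyt _)
    (Eventually.of_forall fun k => hrt _ (mem_iUnion.2 ⟨_, hw k⟩))
  have e₃ : G x (fun i => r (t i)) = G y (fun i => r (t i)) :=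
    (hG x).eq_on_closure (hG y) hxy fun j => hrC (t j)
  have hge : ε ≤ |G x t - G y t| :=
    ge_of_tendsto ((hxt t).sub (hyt t)).abs (Eventually.of_forall hle)
  rw [← e₁, ← e₂, e₃, sub_self, abs_zero] at hge
  exact hε.not_ge hge

/-- A chain of countable sets of length `ω₁`, each of which contains the values at its predecessors
of a given map `Φ`. -/
theorem exists_omegaOne_chain {X : Type v} (Φ : Set X → Set X)
    (hΦ : ∀ C, C.Countable → (Φ C).Countable) :
    ∃ (I : Type) (_ : LinearOrder I) (C : I → Set X), ¬ (univ : Set I).Countable ∧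
      (∀ a : I, (Iic a).Countable) ∧ (∀ a, (C a).Countable) ∧ ∀ a b, a < b → Φ (C a) ⊆ C b := by
  let I : Type := (Cardinal.aleph 1).ord.ToType
  have hcard : Cardinal.mk I = Cardinal.aleph 1 := Cardinal.mk_ord_toType _
  have hIio : ∀ a : I, (Iio a).Countable := fun a => by
    have := Cardinal.mk_Iio_lt a (by rw [hcard, Ordinal.type_toType])
    rwa [hcard, Cardinal.lt_aleph_one_iff, Cardinal.le_aleph0_iff_set_countable] at this
  have hwf : WellFounded ((· < ·) : I → I → Prop) := wellFounded_lt
  refine ⟨I, inferInstance, hwf.fix fun a C => ⋃ b : Iio a, Φ (C b b.2), fun h => ?_,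
    fun a => ?_, fun a => ?_, fun a b hab => ?_⟩
  · rw [← Cardinal.le_aleph0_iff_set_countable, Cardinal.mk_univ, hcard] at h
    exact h.not_gt Cardinal.aleph0_lt_aleph_one
  · rw [← Iio_insert]
    exact (hIio a).insert a
  · induction a using hwf.induction with
    | _ a ih =>
      rw [hwf.fix_eq]
      have := (hIio a).to_subtype
      exact countable_iUnion fun b => hΦ _ (ih b b.2)
  · rw [hwf.fix_eq _ b]
    exact subset_iUnion_of_subset ⟨a, hab⟩ Subset.rfl

/-- If `G` is separately continuous on a compact space of caliber `ω₁` and the functions `G d` are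
determined by countable sets, then the functions `G d` are told apart by their values on one
countable set. -/
theorem exists_countable_forall_eq {X : Type v} [TopologicalSpace X] [CompactSpace X]
    (hcal : HasCaliberOmegaOne X) {n : ℕ} {G : X → (Fin n → X) → ℝ}
    (hG : ∀ d, SepCont (G d)) (hG' : ∀ t, Continuous fun d => G d t)
    (hdet : ∀ d, ∃ C : Set X, C.Countable ∧ Determines (G d) C) :
    ∃ C : Set X, C.Countable ∧ ∀ x y,
      (∀ c : Fin n → X, (∀ j, c j ∈ C) → G x c = G y c) → G x = G y := by
  rcases isEmpty_or_nonempty X with hX | hX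
  · exact ⟨∅, countable_empty, fun x => hX.elim x⟩
  by_contra! hcon
  choose! v w hvw hne using hcon
  choose B hBc hB using hdet
  have happ : ∀ C : Set X, C.Countable → ∃ A : Set X, A.Countable ∧ ∀ x, ∃ r ∈ closure A,
      ∀ d ∈ C, ∀ c : Fin n → X, (∀ j, c j ∈ C) → ∀ i, G d (update c i r) = G d (update c i x) := by
    intro C hC
    have := hC.to_subtype
    obtain ⟨A, hA, hA'⟩ := exists_countable_forall_mem_closure_eq
      (fun (p : C × (Fin n → C) × Fin n) x => G p.1 (update (fun j => (p.2.1 j : X)) p.2.2 x))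
      (fun p => hG _ _ _)
    refine ⟨A, hA, fun x => ?_⟩
    obtain ⟨r, hr, h⟩ := hA' x
    exact ⟨r, hr, fun d hd c hc i => h (⟨d, hd⟩, fun j => ⟨c j, hc j⟩, i)⟩
  choose! A hAc hA using happ
  -- Each stage absorbs what `not_forall_le_abs_sub` asks of the next set: determining sets,
  -- approximating points and the bad pair.
  obtain ⟨I, _, C, hI, hIic, hCc, hC⟩ := exists_omegaOne_chain
    (fun C => C ∪ (⋃ d ∈ C, B d) ∪ A C ∪ {v C, w C}) (fun C hC =>
      ((hC.union (hC.biUnion fun d _ => hBc d)).union (hAc C hC)).union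
        ((countable_singleton _).insert _))
  have hdiff : ∀ a, ∃ t, G (v (C a)) t - G (w (C a)) t ≠ 0 := fun a => by
    obtain ⟨t, ht⟩ := Function.ne_iff.1 (hne _ (hCc a))
    exact ⟨t, sub_ne_zero.2 ht⟩
  choose t ht using hdiff
  obtain ⟨S, -, hS, z, hz⟩ := hcal.exists_common_ne_zero hI
    (fun a s => G (v (C a)) s - G (w (C a)) s)
    (fun a s i => (hG _ s i).sub (hG _ s i)) t ht
  obtain ⟨m, hm⟩ : ∃ m : ℕ,
      ¬ (S ∩ {a | 1 / ((m : ℝ) + 1) ≤ |G (v (C a)) z - G (w (C a)) z|}).Countable := by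
    by_contra! h
    refine hS ((countable_iUnion h).mono fun a ha => ?_)
    obtain ⟨m, hm⟩ := exists_nat_one_div_lt (abs_pos.2 (hz a ha))
    exact mem_iUnion.2 ⟨m, ha, hm.le⟩
  set T := S ∩ {a | 1 / ((m : ℝ) + 1) ≤ |G (v (C a)) z - G (w (C a)) z|} with hT
  -- `T` is uncountable and initial segments are countable, so `T` is cofinal.
  have hnext : ∀ a, ∃ b ∈ T, a < b := by
    intro a
    by_contra! h
    exact hm ((hIic a).mono h)
  choose next hnT hnext using hnext
  obtain ⟨a₀, ha₀⟩ : T.Nonempty := nonempty_iff_ne_empty.2 fun h => hm (h ▸ countable_empty)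
  let s : ℕ → I := fun k => Nat.rec a₀ (fun _ a => next a) k
  have hs : ∀ k, s k < s (k + 1) := fun k => hnext _
  have hsT : ∀ k, s k ∈ T := fun k => by
    cases k with
    | zero => exact ha₀
    | succ k => exact hnT _
  have hsub : ∀ k, _ ⊆ C (s (k + 1)) := fun k => hC _ _ (hs k)
  refine not_forall_le_abs_sub hG hG' (C := fun k => C (s k)) (v := fun k => v (C (s k)))
    (w := fun k => w (C (s k))) (monotone_nat_of_le_succ fun k x hx => hsub k (by simp [hx]))
    (fun k d hd => (hB d).mono fun x hx => hsub k ?_) (fun k x => ?_)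
    (fun k => hsub k (by simp)) (fun k => hsub k (by simp)) (fun k => hvw _ (hCc _)) z
    (Nat.one_div_pos_of_nat (n := m)) fun k => (hsT k).2
  · exact Or.inl (Or.inl (Or.inr (mem_biUnion hd hx)))
  · obtain ⟨r, hr, h⟩ := hA _ (hCc (s k)) x
    exact ⟨r, closure_mono (fun y hy => hsub k (by simp [hy])) hr, h⟩

/-- In a compact space of caliber `ω₁`, every separately continuous function is determined in each
of its variables by countably many values of the other variables. -/
theorem SepCont.exists_countable_determines {X : Type v} [TopologicalSpace X] [CompactSpace X]
    (hcal : HasCaliberOmegaOne X) {n : ℕ} {F : (Fin n → X) → ℝ} (hF : SepCont F) :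
    ∃ C : Set X, C.Countable ∧ Determines F C := by
  induction n with
  | zero => exact ⟨∅, countable_empty, fun i => i.elim0⟩
  | succ n ih =>
    rcases isEmpty_or_nonempty X with hX | ⟨⟨x₀⟩⟩
    · exact ⟨∅, countable_empty, fun i x => hX.elim x⟩
    have hone : ∀ i : Fin (n + 1), ∃ C : Set X, C.Countable ∧ ∀ x y,
        (∀ c : Fin n → X, (∀ j, c j ∈ C) → F (i.insertNth x c) = F (i.insertNth y c)) →
          (fun c => F (i.insertNth x c)) = fun c => F (i.insertNth y c) := by
      intro i
      have hs : ∀ d, SepCont fun c : Fin n → X => F (i.insertNth d c) := by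
        intro d c j
        simpa only [Fin.insertNth_update] using hF (i.insertNth d c) (i.succAbove j)
      refine exists_countable_forall_eq hcal hs (fun c => ?_) fun d => ih (hs d)
      simpa only [Fin.update_insertNth] using hF (i.insertNth x₀ c) i
    choose C hCc hC using hone
    -- `x₀` fills the overwritten slot `i`, which `Determines` also requires to lie in the set.
    refine ⟨insert x₀ (⋃ i, C i), (countable_iUnion hCc).insert _, fun i x y hxy c => ?_⟩
    have := congr_fun (hC i x y fun c hc => ?_) (i.removeNth c)
    · simpa only [Fin.insertNth_removeNth] using this
    · have := hxy (i.insertNth x₀ c) fun j => ?_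
      · simpa only [Fin.update_insertNth] using this
      · refine Fin.succAboveCases i ?_ (fun k => ?_) j
        · simp
        · simpa using Or.inr ⟨i, hc k⟩

/-! ### Substituting operations into functions -/

/-- Substitution of the value of an operation for the variable `j` of `F`. The new variables are
appended; the variable `j` stays as a dummy. -/
def substOp {X : Type v} {m n : ℕ} (F : (Fin m → X) → ℝ) (j : Fin m)
    (φ : (Fin n → X) → X) (x : Fin (m + n) → X) : ℝ :=
  F (update (fun k => x (Fin.castAdd n k)) j (φ fun k => x (Fin.natAdd m k)))

theorem substOp_append {X : Type v} {m n : ℕ} (F : (Fin m → X) → ℝ) (j : Fin m)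
    (φ : (Fin n → X) → X) (c : Fin m → X) (a : Fin n → X) :
    substOp F j φ (Fin.append c a) = F (update c j (φ a)) := by
  simp [substOp]

theorem Fin.append_update_left {X : Type v} {m n : ℕ} (c : Fin m → X) (a : Fin n → X) (i : Fin m)
    (y : X) : Fin.append (update c i y) a = update (Fin.append c a) (Fin.castAdd n i) y := by
  ext k
  induction k using Fin.addCases with
  | left k => simp [update_apply]
  | right k => simp [update_apply, Fin.ext_iff]; omega

theorem Fin.append_update_right {X : Type v} {m n : ℕ} (c : Fin m → X) (a : Fin n → X) (i : Fin n)
    (y : X) : Fin.append c (update a i y) = update (Fin.append c a) (Fin.natAdd m i) y := by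
  ext k
  induction k using Fin.addCases with
  | left k => simp [update_apply, Fin.ext_iff]; omega
  | right k => simp [update_apply]

theorem SepCont.substOp {X : Type v} [TopologicalSpace X] {m n : ℕ} {F : (Fin m → X) → ℝ}
    (hF : SepCont F) (j : Fin m) {φ : (Fin n → X) → X}
    (hφ : ∀ x i, Continuous fun y => φ (update x i y)) : SepCont (substOp F j φ) := by
  intro x i
  obtain ⟨⟨c, a⟩, rfl⟩ := (Fin.appendEquiv m n).surjective x
  change Continuous fun y => _root_.substOp F j φ (update (Fin.append c a) i y)
  induction i using Fin.addCases with
  | left i =>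
    simp only [← Fin.append_update_left, substOp_append]
    -- The dummy variable `j` is overwritten, so the function is constant in it.
    by_cases hij : i = j
    · subst hij; simpa using continuous_const
    · simpa only [update_comm hij] using hF (update c j (φ a)) i
  | right i =>
    simp only [← Fin.append_update_right, substOp_append]
    exact (hF c j).comp (hφ a i)

/-- A countable family of separately continuous functions, containing a given function `f` of one
variable and closed under substituting operations from a countable family. -/
theorem exists_countable_family {X : Type v} [TopologicalSpace X] {f : X → ℝ} (hf : Continuous f)
    (𝒪 : ∀ n : ℕ, Set ((Fin n → X) → X)) (h𝒪 : ∀ n, (𝒪 n).Countable)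
    (hcont : ∀ n, ∀ φ ∈ 𝒪 n, ∀ x i, Continuous fun y => φ (update x i y)) :
    ∃ 𝓕 : Set (Σ m, (Fin m → X) → ℝ), 𝓕.Countable ∧ (∀ F ∈ 𝓕, SepCont F.2) ∧
      (⟨1, fun x => f (x 0)⟩ : Σ m, (Fin m → X) → ℝ) ∈ 𝓕 ∧
      ∀ F ∈ 𝓕, ∀ (j : Fin F.1) (n : ℕ), ∀ φ ∈ 𝒪 n, ⟨F.1 + n, substOp F.2 j φ⟩ ∈ 𝓕 := by
  let step : Set (Σ m, (Fin m → X) → ℝ) → Set (Σ m, (Fin m → X) → ℝ) := fun 𝓐 =>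
    ⋃ F ∈ 𝓐, ⋃ j : Fin F.1, ⋃ n, ⋃ φ ∈ 𝒪 n, {⟨F.1 + n, substOp F.2 j φ⟩}
  let 𝓑 : ℕ → Set (Σ m, (Fin m → X) → ℝ) := fun k => step^[k] {⟨1, fun x => f (x 0)⟩}
  have hsucc : ∀ k, 𝓑 (k + 1) = step (𝓑 k) := fun k => iterate_succ_apply' _ _ _
  refine ⟨⋃ k, 𝓑 k, countable_iUnion fun k => ?_, fun F hF => ?_,
    mem_iUnion.2 ⟨0, rfl⟩, fun F hF j n φ hφ => ?_⟩
  · induction k with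
    | zero => exact countable_singleton _
    | succ k ih =>
      rw [hsucc]
      exact ih.biUnion fun F _ => countable_iUnion fun j => countable_iUnion fun n =>
        (h𝒪 n).biUnion fun φ _ => countable_singleton _
  · obtain ⟨k, hk⟩ := mem_iUnion.1 hF
    clear hF
    induction k generalizing F with
    | zero =>
      obtain rfl : F = ⟨1, fun x => f (x 0)⟩ := hk
      intro x i
      obtain rfl : i = 0 := Subsingleton.elim _ _
      simpa using hf
    | succ k ih =>
      rw [hsucc] at hk
      simp only [step, mem_iUnion, mem_singleton_iff] at hk
      obtain ⟨F', hF', j, n, φ, hφ, rfl⟩ := hk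
      exact (ih F' hF').substOp j (hcont n φ hφ)
  · obtain ⟨k, hk⟩ := mem_iUnion.1 hF
    refine mem_iUnion.2 ⟨k + 1, ?_⟩
    rw [hsucc]
    simp only [step, mem_iUnion, mem_singleton_iff]
    exact ⟨F, hk, j, n, φ, hφ, rfl⟩

/-! ### The quotient algebra and the theorem -/

/-- A congruence of a compact semitopological algebra that is the kernel of a countable family of
continuous real functions has a separable metrizable semitopological quotient algebra. -/
theorem exists_metrizable_quotient {E : Type u} [TopologicalSpace E] [ContinuousSignature E]
    {X : Type v} [TopologicalSpace X] [CompactSpace X] [SigAlgebra E X]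
    (hX : IsSemitopologicalAlgebra E X) {J : Type w} [Countable J] {q : J → X → ℝ}
    (hq : ∀ j, Continuous (q j))
    (hcongr : ∀ (n : ℕ) (t : ContinuousSignature.Symbols E n) (x y : Fin n → X),
      (∀ i j, q j (x i) = q j (y i)) → ∀ j, q j (SigAlgebra.op n t x) = q j (SigAlgebra.op n t y))
    {f : X → ℝ} (hf : Continuous f) (hfq : ∀ x y, (∀ j, q j x = q j y) → f x = f y) :
    ∃ (Y : Type v) (_ : TopologicalSpace Y) (_ : SigAlgebra E Y) (g : Y → ℝ) (h : X → Y),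
      TopologicalSpace.SeparableSpace Y ∧ TopologicalSpace.MetrizableSpace Y ∧
      IsSemitopologicalAlgebra E Y ∧ Continuous g ∧ Continuous h ∧ IsAlgebraHom E h ∧
      f = g ∘ h := by
  let Q : X → J → ℝ := fun x j => q j x
  have hQ : Continuous Q := continuous_pi hq
  let s : Setoid X := Setoid.ker Q
  have hrel : ∀ {x y : X}, (⟦x⟧ : Quotient s) = ⟦y⟧ ↔ ∀ j, q j x = q j y := fun {x y} =>
    Quotient.eq.trans ⟨fun h j => congr_fun h j, fun h => funext h⟩
  let e : Quotient s → J → ℝ := Quotient.lift Q fun _ _ h => h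
  have he : Continuous e := hQ.quotient_lift _
  have hinj : Injective e := by
    rintro ⟨x⟩ ⟨y⟩ h
    exact Quotient.sound h
  have hemb : IsClosedEmbedding e := he.isClosedEmbedding hinj
  have hmk : IsQuotientMap (Quotient.mk s) := isQuotientMap_quotient_mk'
  let alg : SigAlgebra E (Quotient s) := ⟨fun n t y => ⟦SigAlgebra.op n t fun i => (y i).out⟧⟩
  have hhom : IsAlgebraHom E (Quotient.mk s) := fun n t x =>
    hrel.2 (hcongr n t _ _ fun i => hrel.1 (Quotient.out_eq _).symm)
  refine ⟨Quotient s, inferInstance, alg, Quotient.lift f fun x y h => hfq x y fun j =>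
    congr_fun h j, Quotient.mk s, ?_, hemb.isEmbedding.metrizableSpace, fun n => ⟨fun y => ?_,
      fun t y i => ?_⟩, hf.quotient_lift _, hmk.continuous, hhom, rfl⟩
  · have := hemb.isEmbedding.secondCountableTopology
    infer_instance
  · exact hmk.continuous.comp ((hX n).1 _)
  · rw [hmk.continuous_iff]
    convert hmk.continuous.comp ((hX n).2 t (fun k => (y k).out) i) using 1
    ext x
    have := hhom n t (update (fun k => (y k).out) i x)
    simp only [comp_apply]
    rw [this]
    congr 1
    ext k
    by_cases hk : k = i
    · subst hk; simp
    · simp [hk]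

theorem theoremt {E : Type u} [TopologicalSpace E] [ContinuousSignature E]
    [TopologicalSpace.SeparableSpace E]
    {X : Type v} [TopologicalSpace X] [CompactSpace X] [T2Space X] [SigAlgebra E X]
    (hX : IsSemitopologicalAlgebra E X) (hcal : HasCaliberOmegaOne X) :
    IsRFactorizable E X := by
  intro f hf
  have hsep : ∀ n, ∃ D : Set (ContinuousSignature.Symbols E n), D.Countable ∧ Dense D := fun n =>
    have : TopologicalSpace.SeparableSpace (ContinuousSignature.Symbols E n) :=
      (ContinuousSignature.isClopen_fiber n).isOpen.isOpenEmbedding_subtypeVal.separableSpace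
    TopologicalSpace.exists_countable_dense _
  choose D hDc hD using hsep
  obtain ⟨𝓕, h𝓕c, h𝓕, hf𝓕, hsubst⟩ := exists_countable_family hf
    (fun n => SigAlgebra.op (E := E) (X := X) n '' D n) (fun n => (hDc n).image _)
    (by rintro n _ ⟨t, -, rfl⟩; exact (hX n).2 t)
  have hdet : ∀ F : 𝓕, ∃ C : Set X, C.Countable ∧ Determines F.1.2 C := fun F =>
    (h𝓕 F F.2).exists_countable_determines hcal
  choose C hCc hC using hdet
  have := h𝓕c.to_subtype
  have := fun F => (hCc F).to_subtype
  let q : (Σ F : 𝓕, Fin F.1.1 × (Fin F.1.1 → C F)) → X → ℝ := fun p x =>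
    p.1.1.2 (update (fun j => (p.2.2 j : X)) p.2.1 x)
  have hq : ∀ x y, (∀ p, q p x = q p y) ↔
      ∀ F ∈ 𝓕, ∀ (j : Fin F.1) c, F.2 (update c j x) = F.2 (update c j y) := fun x y =>
    ⟨fun h F hF j => hC ⟨F, hF⟩ j x y fun c hc => h ⟨⟨F, hF⟩, j, fun k => ⟨c k, hc k⟩⟩,
      fun h p => h p.1 p.1.2 _ _⟩
  refine exists_metrizable_quotient hX (q := q) (fun p => h𝓕 p.1 p.1.2 _ _) ?_ hf ?_
  · intro n t x y hxy
    rw [hq]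
    intro F hF j c
    have hcont : ∀ z : Fin n → X, Continuous fun t : ContinuousSignature.Symbols E n =>
        F.2 (update c j (SigAlgebra.op n t z)) := fun z => (h𝓕 F hF c j).comp ((hX n).1 z)
    refine congr_fun ((hcont x).ext_on (hD n) (hcont y) fun t ht => ?_) t
    -- For `t` in the dense set, the arguments of the operation are variables of a member of `𝓕`, so
    -- each `x i` can be replaced by `y i`.
    have happ := hsubst F hF j n _ (mem_image_of_mem _ ht)
    refine eq_of_forall_update_eq (F := fun a => F.2 (update c j (SigAlgebra.op n t a)))
      fun i a => ?_
    have := (hq _ _).1 (hxy i) _ happ (Fin.natAdd F.1 i) (Fin.append c a)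
    simpa only [← Fin.append_update_right, substOp_append] using this
  · intro x y hxy
    simpa using (hq x y).1 hxy _ hf𝓕 0 fun _ => x
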